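/- **Theorem 1.6.** Let $N\ge 1$ and let $\rho_n:\mathbb{R}^N\to[0,\infty)$, $n\in\mathbb{N}$, be integrable radial functions ($\rho_n(x)=\rho_n(y)$ whenever $|x|=|y|$) such that $\int_{\mathbb{R}^N}\rho_n(x)\,dx=1$ for every $n$ and $\lim_{n\to\infty}\int_{|x|>\gamma}\rho_n(x)\,dx=0$ for every $\gamma>0$. Let $u\in \mathrm{BV}^2(\mathbb{R}^N)$, i.e. $u\in W^{1,1}(\mathbb{R}^N)$ and the distributional derivative $D^2u:=D(\nabla u)$ of its weak gradient is a finite $\mathbb{R}^{N\times N}$-valued Radon measure. For each $n$ let $$H_nu(x):=\frac{N(N+2)}{2}\int_{\mathbb{R}^N}\frac{u(x+h)-2u(x)+u(x-h)}{|h|^2}\,\frac{h\otimes h-\frac{|h|^2}{N+2}I_N}{|h|^2}\,\rho_n(h)\,dh .$$ Then for every $n$ the integral defining $H_nu(x)$ exists as a Lebesgue integral for almost every $x\in\mathbb{R}^N$, $H_nu\in L^1(\mathbb{R}^N,\mathbb{R}^{N\times N})$, and the finite $\mathbb{R}^{N\times N}$-valued Radon measures $\mu_n:=H_nu\,\mathcal{L}^N$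 converge weakly$^*$ to $D^2u$ as $n\to\infty$: for every $\phi\in C_0(\mathbb{R}^N,\mathbb{R}^{N\times N})$ (continuous and vanishing at infinity), $$\lim_{n\to\infty}\int_{\mathbb{R}^N}\phi\cdot d\mu_n=\lim_{n\to\infty}\int_{\mathbb{R}^N}H_nu(x)\cdot\phi(x)\,dx=\int_{\mathbb{R}^N}\phi(x)\cdot dD^2u ,$$ where $A\cdot B=\sum_{i,j=1}^N A_{ij}B_{ij}$. -/

import Mathlib

open MeasureTheory Filter
open scoped Topology ContDiff ZeroAtInfty

namespace NonlocalHessian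

noncomputable section

/-- The Euclidean space `ℝ^N` (with its Euclidean norm and Lebesgue measure `volume`). -/
abbrev RN (N : ℕ) : Type := EuclideanSpace ℝ (Fin N)

/-- The classical partial derivative `∂φ/∂x_i` at `x`. -/
def partialDeriv {N : ℕ} (i : Fin N) (φ : RN N → ℝ) (x : RN N) : ℝ :=
  fderiv ℝ φ x (EuclideanSpace.single i 1)

/-- `φ ∈ C_c^∞(ℝ^N)`. -/
def IsTest {N : ℕ} (φ : RN N → ℝ) : Prop :=
  ContDiff ℝ ∞ φ ∧ HasCompactSupport φ

/-- The function `g` is the weak `i`-th partial derivative of `f`. It is used below only for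
integrable `f` and `g`. -/
def IsWeakPartial {N : ℕ} (i : Fin N) (f g : RN N → ℝ) : Prop :=
  ∀ φ : RN N → ℝ, IsTest φ → ∫ x, f x * partialDeriv i φ x = -∫ x, g x * φ x

/-- The finite signed Borel measure `μ` is the distributional `i`-th partial derivative of `f`.
(Every finite signed Borel measure on `ℝ^N` is a Radon measure.) -/
def IsMeasurePartial {N : ℕ} (i : Fin N) (f : RN N → ℝ) (μ : SignedMeasure (RN N)) : Prop :=
  ∀ φ : RN N → ℝ, IsTest φ →
    ∫ x, f x * partialDeriv i φ x =
      -VectorMeasure.integral μ φ (ContinuousLinearMap.lsmul ℝ ℝ)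

/-- `g` is the weak gradient of `u`, and its components are integrable. -/
def IsWeakGradient {N : ℕ} (u : RN N → ℝ) (g : Fin N → RN N → ℝ) : Prop :=
  ∀ i, Integrable (g i) ∧ IsWeakPartial i u (g i)

/-- The (matrix-valued, componentwise) measure `D` is the distributional derivative of the vector
field `g`: the entry `D i j` is the `j`-th partial derivative of the component `g i`. -/
def IsMeasureDeriv {N : ℕ} (g : Fin N → RN N → ℝ)
    (D : Fin N → Fin N → SignedMeasure (RN N)) : Prop :=
  ∀ i j, IsMeasurePartial j (g i) (D i j)

/-- `u ∈ W^{1,1}(ℝ^N)`. -/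
def MemW11 {N : ℕ} (u : RN N → ℝ) : Prop :=
  Integrable u ∧ ∃ g, IsWeakGradient u g

/-- `g ∈ BV(ℝ^N, ℝ^N)`. -/
def MemBV {N : ℕ} (g : Fin N → RN N → ℝ) : Prop :=
  (∀ i, Integrable (g i)) ∧ ∃ D, IsMeasureDeriv g D

/-- `u ∈ BV²(ℝ^N)`: `u ∈ W^{1,1}(ℝ^N)` and `∇u ∈ BV(ℝ^N, ℝ^N)`. -/
def MemBV2 {N : ℕ} (u : RN N → ℝ) : Prop :=
  MemW11 u ∧ ∃ g, IsWeakGradient u g ∧ MemBV g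

/-- `D = D²u = D(∇u)`. -/
def IsHessianMeasure {N : ℕ} (u : RN N → ℝ) (D : Fin N → Fin N → SignedMeasure (RN N)) : Prop :=
  ∃ g, IsWeakGradient u g ∧ IsMeasureDeriv g D

/-- The sequence of radial weights: nonnegative radial functions on `ℝ^N` of integral one whose
mass concentrates at the origin. -/
structure IsRadialMollifierSeq {N : ℕ} (ρ : ℕ → RN N → ℝ) : Prop where
  radial : ∀ n x y, ‖x‖ = ‖y‖ → ρ n x = ρ n y
  nonneg : ∀ n x, 0 ≤ ρ n x
  integrable : ∀ n, Integrable (ρ n)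
  integral_eq_one : ∀ n, ∫ x, ρ n x = 1
  tendsto_tail : ∀ γ : ℝ, 0 < γ → Tendsto (fun n => ∫ x in {x | γ < ‖x‖}, ρ n x) atTop (𝓝 0)

/-- The matrix `h ⊗ h - (|h|² / (N + 2)) I_N`. -/
def kernelMatrix {N : ℕ} (h : RN N) : Matrix (Fin N) (Fin N) ℝ :=
  Matrix.of (fun i j => h i * h j) - (‖h‖ ^ 2 / ((N : ℝ) + 2)) • (1 : Matrix (Fin N) (Fin N) ℝ)

/-- The `(i, j)` entry of the integrand, as a function of `h`, of the non-local Hessian at `x`. -/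
def hessianIntegrand {N : ℕ} (r u : RN N → ℝ) (i j : Fin N) (x h : RN N) : ℝ :=
  (u (x + h) - 2 * u x + u (x - h)) / ‖h‖ ^ 2 * (kernelMatrix h i j / ‖h‖ ^ 2) * r h

/-- The non-local Hessian of `u` with weight `r`, as a Lebesgue integral taken entrywise. -/
def nonlocalHessian {N : ℕ} (r u : RN N → ℝ) (x : RN N) : Matrix (Fin N) (Fin N) ℝ :=
  Matrix.of fun i j => (N : ℝ) * ((N : ℝ) + 2) / 2 * ∫ h, hessianIntegrand r u i j x h

/-- The `ℝ^{N×N}`-valued measure `H u 𝓛^N`, entry by entry. -/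
def nonlocalHessianMeasure {N : ℕ} (r u : RN N → ℝ) :
    Fin N → Fin N → SignedMeasure (RN N) :=
  fun i j => (volume : Measure (RN N)).withDensityᵥ (fun x => nonlocalHessian r u x i j)

/-- The pairing `∫ φ · dμ = ∑_{i,j} ∫ φ_{ij} dμ_{ij}`. -/
def pairing {N : ℕ} (φ : RN N → Matrix (Fin N) (Fin N) ℝ)
    (μ : Fin N → Fin N → SignedMeasure (RN N)) : ℝ :=
  ∑ i, ∑ j, VectorMeasure.integral (μ i j) (fun x => φ x i j) (ContinuousLinearMap.lsmul ℝ ℝ)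

/-- Weak* convergence of `ℝ^{N×N}`-valued finite Radon measures, in duality with
`C_0(ℝ^N, ℝ^{N×N})`. -/
def TendstoWeakStar {N : ℕ} (μ : ℕ → Fin N → Fin N → SignedMeasure (RN N))
    (ν : Fin N → Fin N → SignedMeasure (RN N)) : Prop :=
  ∀ φ : C₀(RN N, Matrix (Fin N) (Fin N) ℝ),
    Tendsto (fun n => pairing φ (μ n)) atTop (𝓝 (pairing φ ν))

end

end NonlocalHessian

/-! Fix a direction `h` and pair the second difference of `u` with a test function `φ`. By
translation invariance this is the second difference of `F(t) = ∫ u(x) φ(x + t h) dx`, and two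
integrations by parts give `F''(t) = ∑ h_k h_l ∫ φ(x + t h) dD_{lk}`. Hence the pairing equals the
quadratic form `quadIntegral D h φ` up to `|h|²` times the oscillation of `φ` at scale `|h|` times
the mass of `D` (`abs_integral_secondDiff_mul_sub_le`). No derivative of `φ` enters this error, so
it extends to all of `C₀` by density.

By duality, second differences have `L¹` norm `O(|h|²)` (`integral_abs_secondDiff_le`). This absorbs
the `|h|⁻²` singularity of the kernel and gives absolute integrability in `(x, h)`, hence existence
of the integral for a.e. `x` and Fubini.

Fourth moments of a radial density are isotropic, and the trace correction and the constant
`N(N+2)/2` are chosen so that averaging the quadratic form of a symmetric matrix returns the matrix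
exactly, for every `n` (`integral_kernelWeight_mul_quadratic`). Only the oscillation error remains:
it is small for small `h`, and the mass of `ρ n` on the other `h` tends to zero. -/

namespace NonlocalHessian

/-! ### A one-variable Taylor estimate and smooth approximation. -/

/-- The second-order difference of a function of one real variable differs from `c` by at most the
maximal distance of the second derivative to `c`. -/
lemma abs_second_difference_sub_le {F F' F'' : ℝ → ℝ} {c M : ℝ}
    (hF : ∀ t, HasDerivAt F (F' t) t) (hF' : ∀ t, HasDerivAt F' (F'' t) t)
    (hM : ∀ t, |t| ≤ 1 → |F'' t - c| ≤ M) :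
    |F 1 - 2 * F 0 + F (-1) - c| ≤ M := by
  -- Two mean value inequalities, first for `F' s - c s` on `[-t, t]`, then for `F s + F (-s) - c s²
  -- - 2 F 0` against `M s²`; continuity of `F''` is never needed.
  have key : ∀ t ∈ Set.Ico (0 : ℝ) 1, ‖F' t - F' (-t) - 2 * c * t‖ ≤ 2 * M * t := by
    intro t ht
    have h := (convex_Icc (-t) t).norm_image_sub_le_of_norm_hasDerivWithin_le
      (f := fun s => F' s - c * s) (f' := fun s => F'' s - c) (C := M) (x := -t) (y := t)
      (fun s _ => (by
        simpa using! ((hF' s).sub ((hasDerivAt_id s).const_mul c)) :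
          HasDerivAt (fun s => F' s - c * s) (F'' s - c) s).hasDerivWithinAt)
      (fun s hs => hM s (abs_le.2 ⟨by linarith [hs.1, ht.2], by linarith [hs.2, ht.2]⟩))
      ⟨le_rfl, by linarith [ht.1]⟩ ⟨by linarith [ht.1], le_rfl⟩
    have e : F' t - F' (-t) - 2 * c * t = F' t - c * t - (F' (-t) - c * -t) := by ring
    rw [e]
    refine h.trans (le_of_eq ?_)
    rw [Real.norm_of_nonneg (by linarith [ht.1])]
    ring
  have hd : ∀ t, HasDerivAt (fun s => F s + F (-s) - c * s ^ 2 - 2 * F 0)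
      (F' t - F' (-t) - 2 * c * t) t := by
    intro t
    have h1 : HasDerivAt (fun s => F (-s)) (-F' (-t)) t := by
      simpa using! (hF (-t)).comp t (hasDerivAt_neg t)
    have h2 : HasDerivAt (fun s : ℝ => c * s ^ 2) (c * (2 * t)) t := by
      simpa using (hasDerivAt_pow 2 t).const_mul c
    have h3 := (((hF t).add h1).sub h2).sub_const (2 * F 0)
    exact h3.congr_deriv (by ring)
  have hB : ∀ t, HasDerivAt (fun s : ℝ => M * s ^ 2) (2 * M * t) t := by
    intro t
    have h2 : HasDerivAt (fun s : ℝ => M * s ^ 2) (M * (2 * t)) t := by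
      simpa using (hasDerivAt_pow 2 t).const_mul M
    exact h2.congr_deriv (by ring)
  have := image_norm_le_of_norm_deriv_right_le_deriv_boundary
    (f := fun s => F s + F (-s) - c * s ^ 2 - 2 * F 0) (a := 0) (b := 1)
    (fun t _ => (hd t).continuousAt.continuousWithinAt)
    (fun t _ => (hd t).hasDerivWithinAt) (B := fun s => M * s ^ 2) (by simp; ring_nf)
    (fun t => hB t) key (x := 1) (by simp)
  calc |F 1 - 2 * F 0 + F (-1) - c| = ‖F 1 + F (-1) - c * 1 ^ 2 - 2 * F 0‖ := by
        rw [Real.norm_eq_abs]; congr 1; ring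
    _ ≤ M := by simpa using this

/-- Smooth compactly supported functions are uniformly dense in the continuous functions vanishing
at infinity. -/
lemma exists_isTest_approx {N : ℕ} {φ : RN N → ℝ} (hφ : Continuous φ)
    (h0 : Tendsto φ (cocompact _) (𝓝 0)) {ε : ℝ} (hε : 0 < ε) :
    ∃ ψ, IsTest ψ ∧ ∀ x, |ψ x - φ x| ≤ ε := by
  -- Soft thresholding: `χ` vanishes wherever `|φ| ≤ ε / 2`, so it has compact support without any
  -- cutoff function.
  let χ : RN N → ℝ := fun x => φ x - max (-(ε / 2)) (min (ε / 2) (φ x))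
  have hχ : Continuous χ := by fun_prop
  have hd : ∀ x, |χ x - φ x| ≤ ε / 2 := by
    intro x
    simp only [χ]
    rw [abs_le]
    constructor
    · have : max (-(ε / 2)) (min (ε / 2) (φ x)) ≤ ε / 2 :=
        max_le (by linarith) (min_le_left _ _)
      linarith
    · have := le_max_left (-(ε / 2)) (min (ε / 2) (φ x))
      linarith
  have hs : HasCompactSupport χ := by
    have h1 : ∀ᶠ x in cocompact (RN N), |φ x| < ε / 2 := by
      have := h0.abs
      rw [abs_zero] at this
      exact this.eventually_lt_const (by linarith)
    obtain ⟨K, hK, hKs⟩ := mem_cocompact.1 h1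
    refine HasCompactSupport.intro hK fun x hx => ?_
    have hx' : |φ x| < ε / 2 := hKs hx
    rw [abs_lt] at hx'
    simp only [χ]
    rw [min_eq_right hx'.2.le, max_eq_right hx'.1.le, sub_self]
  obtain ⟨ψ, hψ, hψd, hψs⟩ := hχ.exists_contDiff_approx ⊤ (ε := fun _ => ε / 2)
    continuous_const (fun _ => by linarith)
  refine ⟨ψ, ⟨hψ, hs.mono hψs⟩, fun x => ?_⟩
  have h1 := hψd x
  rw [Real.dist_eq] at h1
  calc |ψ x - φ x| ≤ |ψ x - χ x| + |χ x - φ x| := abs_sub_le _ _ _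
    _ ≤ ε := by linarith [hd x]

/-! ### Test functions and their translates. -/

section Test

variable {N : ℕ} {φ : RN N → ℝ}

lemma IsTest.partialDeriv (hφ : IsTest φ) (i : Fin N) : IsTest (partialDeriv i φ) := by
  refine ⟨?_, ?_⟩
  · have : ContDiff ℝ ∞ (fderiv ℝ φ) := hφ.1.fderiv_right (by simp)
    exact this.clm_apply contDiff_const
  · have h := (hφ.2.fderiv ℝ)
    exact h.comp_left (g := fun L : RN N →L[ℝ] ℝ => L (EuclideanSpace.single i 1)) (by simp)

lemma IsTest.comp_add_right (hφ : IsTest φ) (a : RN N) : IsTest (fun x => φ (x + a)) :=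
  ⟨hφ.1.comp (contDiff_id.add contDiff_const),
    hφ.2.comp_homeomorph (Homeomorph.addRight a)⟩

lemma partialDeriv_comp_add_right (i : Fin N) (a x : RN N) :
    partialDeriv i (fun y => φ (y + a)) x = partialDeriv i φ (x + a) := by
  simp [partialDeriv, fderiv_comp_add_right]

lemma IsTest.continuous (hφ : IsTest φ) : Continuous φ := hφ.1.continuous

lemma IsTest.exists_bound (hφ : IsTest φ) : ∃ C, ∀ x, ‖φ x‖ ≤ C :=
  hφ.2.exists_bound_of_continuous hφ.continuous

lemma IsTest.hasDerivAt_line (hφ : IsTest φ) (x h : RN N) (t : ℝ) :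
    HasDerivAt (fun s : ℝ => φ (x + s • h))
      (∑ k, h k * NonlocalHessian.partialDeriv k φ (x + t • h)) t := by
  have h1 : HasFDerivAt φ (fderiv ℝ φ (x + t • h)) (x + t • h) :=
    (hφ.1.differentiable (by simp) _).hasFDerivAt
  have h2 : HasDerivAt (fun s : ℝ => x + s • h) h t := by
    simpa using ((hasDerivAt_id t).smul_const h).const_add x
  have h3 := h1.comp_hasDerivAt t h2
  refine h3.congr_deriv ?_
  have e : h = ∑ k, h k • (EuclideanSpace.single k (1 : ℝ) : RN N) := by
    ext j
    simp [Finset.sum_apply, Pi.single_apply]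
  calc fderiv ℝ φ (x + t • h) h
      = fderiv ℝ φ (x + t • h) (∑ k, h k • (EuclideanSpace.single k (1 : ℝ) : RN N)) := by rw [← e]
    _ = _ := by
      rw [map_sum]
      exact Finset.sum_congr rfl fun k _ => by rw [map_smul, smul_eq_mul]; rfl

/-- Differentiation under the integral sign, for the integral of an integrable function against the
translates of a test function. -/
lemma hasDerivAt_integral_mul_translate {u : RN N → ℝ} (hu : Integrable u) (hφ : IsTest φ)
    (h : RN N) (t : ℝ) :
    HasDerivAt (fun s : ℝ => ∫ x, u x * φ (x + s • h))
      (∑ k, h k * ∫ x, u x * partialDeriv k φ (x + t • h)) t := by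
  have hint : ∀ {ψ : RN N → ℝ}, IsTest ψ → ∀ a, Integrable (fun x => u x * ψ (x + a)) := by
    intro ψ hψ a
    obtain ⟨C, hC⟩ := hψ.exists_bound
    exact hu.mul_bdd (c := C) (hψ.comp_add_right a).continuous.aestronglyMeasurable
      (ae_of_all _ fun x => hC _)
  choose C hC using fun k => (hφ.partialDeriv k).exists_bound
  have hF := (hasDerivAt_integral_of_dominated_loc_of_deriv_le (μ := volume) (x₀ := t)
    (F := fun s x => u x * φ (x + s • h))
    (F' := fun s x => u x * ∑ k, h k * partialDeriv k φ (x + s • h))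
    (bound := fun x => |u x| * ∑ k, |h k| * C k) univ_mem
    (Eventually.of_forall fun s => (hint hφ _).aestronglyMeasurable) (hint hφ _) ?_
    (ae_of_all _ fun x s _ => ?_) (hu.abs.mul_const _)
    (ae_of_all _ fun x s _ => (hφ.hasDerivAt_line x h s).const_mul _)).2
  · refine hF.congr_deriv ?_
    simp_rw [Finset.mul_sum]
    rw [integral_finsetSum _ fun k _ => ?_]
    · refine Finset.sum_congr rfl fun k _ => ?_
      rw [← integral_const_mul]
      congr 1 with x
      ring
    · refine ((hint (hφ.partialDeriv k) (t • h)).const_mul (h k)).congr (ae_of_all _ fun x => ?_)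
      ring
  · refine hu.aestronglyMeasurable.mul (Continuous.aestronglyMeasurable ?_)
    exact continuous_finsetSum _ fun k _ =>
      continuous_const.mul ((hφ.partialDeriv k).comp_add_right _).continuous
  · rw [norm_mul, Real.norm_eq_abs]
    gcongr
    refine (norm_sum_le _ _).trans (Finset.sum_le_sum fun k _ => ?_)
    rw [norm_mul, Real.norm_eq_abs]
    gcongr
    exact hC k _

end Test

/-- Closes each density argument; `K` is fixed before `ε` and may have any sign. -/
lemma le_of_forall_pos_le_add_mul {a b K : ℝ} (h : ∀ ε > 0, a ≤ b + ε * K) : a ≤ b := by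
  have ht : Tendsto (fun ε : ℝ => b + ε * K) (𝓝[>] 0) (𝓝 b) := by
    have : Tendsto (fun ε : ℝ => b + ε * K) (𝓝 0) (𝓝 (b + 0 * K)) := by
      apply Continuous.tendsto
      fun_prop
    simpa using! this.mono_left nhdsWithin_le_nhds
  exact ge_of_tendsto ht (eventually_mem_nhdsWithin.mono fun ε hε => h ε hε)

instance isFiniteMeasure_variation {X : Type*} [MeasurableSpace X] (μ : SignedMeasure X) :
    IsFiniteMeasure μ.variation := by
  rw [← SignedMeasure.totalVariation_eq_variation, SignedMeasure.totalVariation]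
  infer_instance

/-! ### Integration against finite signed measures. -/

section SignedIntegral

variable {N : ℕ}

/-- The integral of a real function against a signed measure. -/
noncomputable abbrev signedIntegral (μ : SignedMeasure (RN N)) (φ : RN N → ℝ) : ℝ :=
  VectorMeasure.integral μ φ (ContinuousLinearMap.lsmul ℝ ℝ)

lemma abs_signedIntegral_le (μ : SignedMeasure (RN N)) {φ : RN N → ℝ} {C : ℝ}
    (h : ∀ x, |φ x| ≤ C) : |signedIntegral μ φ| ≤ C * μ.variation.real Set.univ := by
  have := VectorMeasure.norm_integral_le_of_norm_le_const (μ := μ)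
    (B := ContinuousLinearMap.lsmul ℝ ℝ) (ae_of_all _ h)
  have hC : 0 ≤ C := (abs_nonneg _).trans (h 0)
  refine this.trans ?_
  gcongr
  calc C * ‖(ContinuousLinearMap.lsmul ℝ ℝ : ℝ →L[ℝ] ℝ →L[ℝ] ℝ)‖ ≤ C * 1 := by
        gcongr; exact ContinuousLinearMap.opNorm_lsmul_le
    _ = C := mul_one C

lemma integrable_variation_of_bound (μ : SignedMeasure (RN N)) {φ : RN N → ℝ} (hφ : Continuous φ)
    {C : ℝ} (h : ∀ x, |φ x| ≤ C) : μ.Integrable φ :=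
  Integrable.of_bound hφ.aestronglyMeasurable C (ae_of_all _ h)

lemma abs_signedIntegral_sub_le (μ : SignedMeasure (RN N)) {φ ψ : RN N → ℝ} (hφ : Continuous φ)
    (hψ : Continuous ψ) {C C' ε : ℝ} (hC : ∀ x, |φ x| ≤ C) (hC' : ∀ x, |ψ x| ≤ C')
    (hε : ∀ x, |φ x - ψ x| ≤ ε) :
    |signedIntegral μ φ - signedIntegral μ ψ| ≤ ε * μ.variation.real Set.univ := by
  rw [signedIntegral, signedIntegral, ← VectorMeasure.integral_fun_sub
    (integrable_variation_of_bound μ hφ hC) (integrable_variation_of_bound μ hψ hC')]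
  exact abs_signedIntegral_le μ hε

/-- Links the two forms of the conclusion, with measures and with densities, by splitting `f` into
positive and negative parts. -/
lemma signedIntegral_withDensityᵥ {f : RN N → ℝ} (hf : Integrable f) {φ : RN N → ℝ}
    (hφ : Continuous φ) {C : ℝ} (hC : ∀ x, |φ x| ≤ C) :
    signedIntegral (volume.withDensityᵥ f) φ = ∫ x, f x * φ x := by
  have hflip : (ContinuousLinearMap.lsmul ℝ ℝ : ℝ →L[ℝ] ℝ →L[ℝ] ℝ) =
      (ContinuousLinearMap.lsmul ℝ ℝ : ℝ →L[ℝ] ℝ →L[ℝ] ℝ).flip := by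
    ext; simp
  have hp : ∀ {f : RN N → ℝ}, Integrable f →
      Integrable (fun x => (ENNReal.ofReal (f x)).toReal * φ x) ∧
      ∀ [IsFiniteMeasure (volume.withDensity fun x => ENNReal.ofReal (f x))],
      signedIntegral (volume.withDensity fun x => ENNReal.ofReal (f x)).toSignedMeasure φ =
        ∫ x, (ENNReal.ofReal (f x)).toReal * φ x := by
    intro f hf
    constructor
    · refine Integrable.mul_bdd (c := C) ?_ hφ.aestronglyMeasurable (ae_of_all _ hC)
      simpa [ENNReal.toReal_ofReal'] using hf.pos_part
    · intro _
      rw [signedIntegral, hflip, VectorMeasure.integral_toSignedMeasure,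
        integral_withDensity_eq_integral_toReal_smul₀ hf.aemeasurable.ennreal_ofReal
          (ae_of_all _ fun x => ENNReal.ofReal_lt_top)]
      rfl
  have hfin := isFiniteMeasure_withDensity_ofReal hf.2
  have hfin' := isFiniteMeasure_withDensity_ofReal hf.neg.2
  simp only [Pi.neg_apply] at hfin'
  rw [withDensityᵥ_eq_withDensity_pos_part_sub_withDensity_neg_part hf, signedIntegral,
    VectorMeasure.integral_sub_vectorMeasure (integrable_variation_of_bound _ hφ hC)
      (integrable_variation_of_bound _ hφ hC)]
  have h1 := (hp hf).2
  have h2 := (hp hf.neg).2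
  have h2' := (hp hf.neg).1
  simp only [Pi.neg_apply] at h2 h2'
  rw [signedIntegral] at h1 h2
  rw [h1, h2, ← integral_sub (hp hf).1 h2']
  congr 1 with x
  rw [ENNReal.toReal_ofReal', ENNReal.toReal_ofReal', ← sub_mul]
  congr 1
  rcases le_total 0 (f x) with h | h
  · rw [max_eq_left h, max_eq_right (by linarith), sub_zero]
  · rw [max_eq_right h, max_eq_left (by linarith)]; ring

end SignedIntegral

/-! ### Second differences of `BV²` functions. -/

section SecondDiff

variable {N : ℕ}

/-- The symmetric second-order difference `u(x + h) - 2 u(x) + u(x - h)`. -/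
noncomputable def secondDiff (u : RN N → ℝ) (h x : RN N) : ℝ := u (x + h) - 2 * u x + u (x - h)

/-- The sum of the total masses of the entries of a matrix of signed measures. -/
noncomputable def totalMass (D : Fin N → Fin N → SignedMeasure (RN N)) : ℝ :=
  ∑ k, ∑ l, (D l k).variation.real Set.univ

lemma totalMass_nonneg (D : Fin N → Fin N → SignedMeasure (RN N)) : 0 ≤ totalMass D := by
  unfold totalMass
  positivity

/-- The integral `∫ ⟨h, φ dD h⟩` of the quadratic form of `D` in the direction `h`. -/
noncomputable def quadIntegral (D : Fin N → Fin N → SignedMeasure (RN N)) (h : RN N)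
    (φ : RN N → ℝ) : ℝ :=
  ∑ k, ∑ l, h k * h l * signedIntegral (D l k) φ

lemma abs_coord_le (h : RN N) (k : Fin N) : |h k| ≤ ‖h‖ := by
  simpa using! PiLp.norm_apply_le h k

lemma abs_quadIntegral_sub_le (D : Fin N → Fin N → SignedMeasure (RN N)) (h : RN N)
    {φ ψ : RN N → ℝ} (hφ : Continuous φ)
    (hψ : Continuous ψ) {C C' ε : ℝ} (hC : ∀ x, |φ x| ≤ C) (hC' : ∀ x, |ψ x| ≤ C')
    (hε : ∀ x, |φ x - ψ x| ≤ ε) :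
    |quadIntegral D h φ - quadIntegral D h ψ| ≤ ‖h‖ ^ 2 * ε * totalMass D := by
  rw [quadIntegral, quadIntegral, totalMass, ← Finset.sum_sub_distrib, Finset.mul_sum]
  refine (Finset.abs_sum_le_sum_abs _ _).trans (Finset.sum_le_sum fun k _ => ?_)
  rw [← Finset.sum_sub_distrib, Finset.mul_sum]
  refine (Finset.abs_sum_le_sum_abs _ _).trans (Finset.sum_le_sum fun l _ => ?_)
  rw [← mul_sub, abs_mul, abs_mul, mul_assoc (‖h‖ ^ 2), sq]
  gcongr
  · exact abs_coord_le h k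
  · exact abs_coord_le h l
  · exact abs_signedIntegral_sub_le _ hφ hψ hC hC' hε

variable {u : RN N → ℝ} {g : Fin N → RN N → ℝ} {D : Fin N → Fin N → SignedMeasure (RN N)}

lemma integrable_secondDiff (hu : Integrable u) (h : RN N) : Integrable (secondDiff u h) :=
  ((hu.comp_add_right h).sub (hu.const_mul 2)).add (hu.comp_sub_right h)

/-- The outer derivative `∂_l` passes to `u` and yields `g l`, the inner `∂_k` then yields `D l k`;
the two signs cancel. -/
lemma integral_mul_partialDeriv_partialDeriv (hg : IsWeakGradient u g) (hD : IsMeasureDeriv g D)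
    {φ : RN N → ℝ} (hφ : IsTest φ) (k l : Fin N) :
    ∫ x, u x * partialDeriv l (partialDeriv k φ) x = signedIntegral (D l k) φ := by
  rw [(hg l).2 _ (hφ.partialDeriv k), hD l k φ hφ, neg_neg]

lemma partialDeriv_comm {φ : RN N → ℝ} (hφ : IsTest φ) (k l : Fin N) (x : RN N) :
    partialDeriv l (partialDeriv k φ) x = partialDeriv k (partialDeriv l φ) x := by
  have hd : DifferentiableAt ℝ (fderiv ℝ φ) x :=
    ((hφ.1.fderiv_right (m := 1) (by norm_num; exact WithTop.coe_le_coe.2 le_top)).differentiable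
      (by simp)) x
  have e : ∀ k l : Fin N, partialDeriv l (partialDeriv k φ) x =
      fderiv ℝ (fderiv ℝ φ) x (EuclideanSpace.single l 1) (EuclideanSpace.single k 1) := by
    intro k l
    unfold partialDeriv
    rw [fderiv_clm_apply hd (differentiableAt_const _)]
    simp
  rw [e, e]
  exact hφ.1.contDiffAt.isSymmSndFDerivAt (by simp; exact WithTop.coe_le_coe.2 le_top) _ _

lemma signedIntegral_comm_of_isTest (hg : IsWeakGradient u g) (hD : IsMeasureDeriv g D)
    {φ : RN N → ℝ} (hφ : IsTest φ) (k l : Fin N) :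
    signedIntegral (D k l) φ = signedIntegral (D l k) φ := by
  rw [← integral_mul_partialDeriv_partialDeriv hg hD hφ,
    ← integral_mul_partialDeriv_partialDeriv hg hD hφ]
  simp_rw [partialDeriv_comm hφ k l]

/-- Translation invariance of Lebesgue measure moves the difference operator, which is even in `h`,
onto `φ`. -/
lemma integral_secondDiff_mul (hu : Integrable u) {φ : RN N → ℝ} (hφ : Continuous φ)
    {C : ℝ} (hC : ∀ x, |φ x| ≤ C) (h : RN N) :
    ∫ x, secondDiff u h x * φ x =
      (∫ x, u x * φ (x + h)) - 2 * (∫ x, u x * φ x) + ∫ x, u x * φ (x - h) := by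
  have hi : ∀ {v : RN N → ℝ}, Integrable v → Integrable (fun x => v x * φ x) := fun hv =>
    hv.mul_bdd (c := C) hφ.aestronglyMeasurable (ae_of_all _ hC)
  have h1 := integral_sub_right_eq_self (μ := volume) (fun x => u (x + h) * φ x) h
  have h2 := integral_add_right_eq_self (μ := volume) (fun x => u (x - h) * φ x) h
  simp only [sub_add_cancel, add_sub_cancel_right] at h1 h2
  have h3 : Integrable (fun x => u (x - h) * φ x - 2 * (u x * φ x)) :=
    (hi (hu.comp_sub_right h)).sub ((hi hu).const_mul 2)
  rw [h1, h2, ← integral_const_mul, ← integral_sub (hi (hu.comp_sub_right h)) ((hi hu).const_mul 2),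
    ← integral_add h3 (hi (hu.comp_add_right h))]
  congr 1 with x
  simp only [secondDiff]
  ring

/-- The Taylor estimate for `F(t) = ∫ u(x) φ(x + t h) dx` with `c = F''(0)`: for `|t| ≤ 1`, `F''(t)`
is the same quadratic form tested on a translate of `φ` by at most `‖h‖`. -/
lemma abs_integral_secondDiff_mul_sub_le_of_isTest (hu : Integrable u) (hg : IsWeakGradient u g)
    (hD : IsMeasureDeriv g D) {φ : RN N → ℝ} (hφ : IsTest φ) {h : RN N} {W : ℝ}
    (hW : ∀ x y, ‖y‖ ≤ ‖h‖ → |φ (x + y) - φ x| ≤ W) :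
    |(∫ x, secondDiff u h x * φ x) - quadIntegral D h φ| ≤ ‖h‖ ^ 2 * W * totalMass D := by
  obtain ⟨C, hC⟩ := hφ.exists_bound
  have hF := fun t => hasDerivAt_integral_mul_translate hu hφ h t
  have hF' : ∀ t : ℝ, HasDerivAt
      (fun t : ℝ => ∑ k, h k * ∫ x, u x * partialDeriv k φ (x + t • h))
      (quadIntegral D h fun x => φ (x + t • h)) t := by
    intro t
    have := HasDerivAt.fun_sum (u := Finset.univ) fun (k : Fin N) _ =>
      (hasDerivAt_integral_mul_translate hu (hφ.partialDeriv k) h t).const_mul (h k)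
    refine this.congr_deriv ?_
    simp only [quadIntegral, Finset.mul_sum]
    refine Finset.sum_congr rfl fun k _ => Finset.sum_congr rfl fun l _ => ?_
    rw [← integral_mul_partialDeriv_partialDeriv hg hD (hφ.comp_add_right (t • h)), mul_assoc]
    congr! 5 with x
    rw [← partialDeriv_comp_add_right]
    congr 1 with y
    exact (partialDeriv_comp_add_right _ _ _).symm
  have key := abs_second_difference_sub_le (c := quadIntegral D h φ) hF hF'
    (M := ‖h‖ ^ 2 * W * totalMass D) fun t ht =>
      abs_quadIntegral_sub_le D h (hφ.comp_add_right (t • h)).continuous hφ.continuous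
        (fun x => hC _) hC fun x => hW x _ (by
          rw [norm_smul, Real.norm_eq_abs]
          exact mul_le_of_le_one_left (norm_nonneg _) ht)
  rw [integral_secondDiff_mul hu hφ.continuous hC]
  simpa [sub_eq_add_neg] using key

lemma exists_bound_of_tendsto_cocompact {φ : RN N → ℝ} (hφ : Continuous φ)
    (h0 : Tendsto φ (cocompact _) (𝓝 0)) : ∃ C, ∀ x, |φ x| ≤ C := by
  obtain ⟨ψ, hψ, h⟩ := exists_isTest_approx hφ h0 one_pos
  obtain ⟨C, hC⟩ := hψ.exists_bound
  refine ⟨C + 1, fun x => ?_⟩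
  have h1 : |ψ x| ≤ C := hC x
  have h2 := abs_sub_abs_le_abs_sub (φ x) (ψ x)
  rw [abs_sub_comm] at h2
  linarith [h x]

lemma abs_integral_mul_sub_le {f : RN N → ℝ} (hf : Integrable f) {φ ψ : RN N → ℝ}
    (hφ : Continuous φ) (hψ : Continuous ψ) {C C' ε : ℝ} (hC : ∀ x, |φ x| ≤ C)
    (hC' : ∀ x, |ψ x| ≤ C') (hε : ∀ x, |φ x - ψ x| ≤ ε) :
    |(∫ x, f x * φ x) - ∫ x, f x * ψ x| ≤ ε * ∫ x, |f x| := by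
  have h1 : Integrable (fun x => f x * φ x) :=
    hf.mul_bdd (c := C) hφ.aestronglyMeasurable (ae_of_all _ hC)
  have h2 : Integrable (fun x => f x * ψ x) :=
    hf.mul_bdd (c := C') hψ.aestronglyMeasurable (ae_of_all _ hC')
  rw [← integral_sub h1 h2, ← integral_const_mul]
  refine (abs_integral_le_integral_abs).trans
    (integral_mono (h1.sub h2).abs (hf.abs.const_mul _) fun x => ?_)
  simp only
  rw [← mul_sub, abs_mul, mul_comm]
  gcongr
  exact hε x

/-- The second-order difference quotients of `u` are close to `D`, when tested against a function
with small oscillation. -/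
lemma abs_integral_secondDiff_mul_sub_le (hu : Integrable u) (hg : IsWeakGradient u g)
    (hD : IsMeasureDeriv g D) {φ : RN N → ℝ} (hφ : Continuous φ)
    (h0 : Tendsto φ (cocompact _) (𝓝 0)) {h : RN N} {W : ℝ}
    (hW : ∀ x y, ‖y‖ ≤ ‖h‖ → |φ (x + y) - φ x| ≤ W) :
    |(∫ x, secondDiff u h x * φ x) - quadIntegral D h φ| ≤ ‖h‖ ^ 2 * W * totalMass D := by
  -- An `ε`-approximation `ψ` oscillates by at most `W + 2ε`; these two `ε` and the one from
  -- replacing `ψ` in `quadIntegral` make the factor 3.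
  refine le_of_forall_pos_le_add_mul
    (K := (∫ x, |secondDiff u h x|) + 3 * (‖h‖ ^ 2 * totalMass D)) fun ε hε => ?_
  obtain ⟨C, hC⟩ := exists_bound_of_tendsto_cocompact hφ h0
  obtain ⟨ψ, hψ, hd⟩ := exists_isTest_approx hφ h0 hε
  obtain ⟨C', hC'⟩ := hψ.exists_bound
  have h1 := abs_integral_mul_sub_le (integrable_secondDiff hu h) hψ.continuous hφ hC' hC hd
  have h2 := abs_quadIntegral_sub_le D h hψ.continuous hφ hC' hC hd
  have h3 := abs_integral_secondDiff_mul_sub_le_of_isTest hu hg hD hψ (h := h) (W := W + 2 * ε)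
    fun x y hy => by
      have a1 := abs_le.1 (hd (x + y))
      have a2 := abs_le.1 (hd x)
      have a3 := abs_le.1 (hW x y hy)
      exact abs_le.2 ⟨by linarith [a1.1, a2.2, a3.1], by linarith [a1.2, a2.1, a3.2]⟩
  rw [abs_le] at h1 h2 h3 ⊢
  constructor <;> nlinarith [h1.1, h1.2, h2.1, h2.2, h3.1, h3.2]

/-- The moment identity sees only the symmetric part of `D`; this symmetry, inherited from commuting
derivatives of test functions, makes it return `D i j` itself. -/
lemma signedIntegral_comm (hg : IsWeakGradient u g) (hD : IsMeasureDeriv g D)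
    {φ : RN N → ℝ} (hφ : Continuous φ) (h0 : Tendsto φ (cocompact _) (𝓝 0)) (k l : Fin N) :
    signedIntegral (D k l) φ = signedIntegral (D l k) φ := by
  refine sub_eq_zero.1 (abs_nonpos_iff.1 (le_of_forall_pos_le_add_mul
    (K := (D k l).variation.real Set.univ + (D l k).variation.real Set.univ) fun ε hε => ?_))
  obtain ⟨C, hC⟩ := exists_bound_of_tendsto_cocompact hφ h0
  obtain ⟨ψ, hψ, hd⟩ := exists_isTest_approx hφ h0 hε
  obtain ⟨C', hC'⟩ := hψ.exists_bound
  have h1 := abs_signedIntegral_sub_le (D k l) hψ.continuous hφ hC' hC hd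
  have h2 := abs_signedIntegral_sub_le (D l k) hψ.continuous hφ hC' hC hd
  have h3 := signedIntegral_comm_of_isTest hg hD hψ k l
  rw [abs_le] at h1 h2 ⊢
  constructor <;> linarith [h1.1, h1.2, h2.1, h2.2]

lemma abs_quadIntegral_le (D : Fin N → Fin N → SignedMeasure (RN N)) (h : RN N)
    {φ : RN N → ℝ} (hφ : Continuous φ) {S : ℝ} (hS : ∀ x, |φ x| ≤ S) :
    |quadIntegral D h φ| ≤ ‖h‖ ^ 2 * S * totalMass D := by
  have := abs_quadIntegral_sub_le D h hφ continuous_zero hS (C' := 0) (ε := S) (by simp)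
    (by simpa using hS)
  have h0 : quadIntegral D h (0 : RN N → ℝ) = 0 := by
    simp only [quadIntegral, signedIntegral]
    simp [VectorMeasure.integral_zero, Pi.zero_def]
  simpa [h0] using this

/-- The crude version for large `h`, where the oscillation is only bounded by `2 * S`. -/
lemma abs_integral_secondDiff_mul_sub_le_of_bound (hu : Integrable u) (hg : IsWeakGradient u g)
    (hD : IsMeasureDeriv g D) {φ : RN N → ℝ} (hφ : Continuous φ)
    (h0 : Tendsto φ (cocompact _) (𝓝 0)) {S : ℝ} (hS : ∀ x, |φ x| ≤ S) (h : RN N) :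
    |(∫ x, secondDiff u h x * φ x) - quadIntegral D h φ| ≤ ‖h‖ ^ 2 * (2 * S) * totalMass D :=
  abs_integral_secondDiff_mul_sub_le hu hg hD hφ h0 fun x y _ => by
    linarith [abs_sub (φ (x + y)) (φ x), hS (x + y), hS x]

/-- The `L¹` norm is the supremum of the integrals against continuous compactly supported functions
bounded by one. -/
lemma integral_abs_le_of_forall {f : RN N → ℝ} (hf : Integrable f) {C : ℝ}
    (h : ∀ φ : RN N → ℝ, Continuous φ → HasCompactSupport φ → (∀ x, |φ x| ≤ 1) →
      ∫ x, f x * φ x ≤ C) : ∫ x, |f x| ≤ C := by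
  -- One `ε` is lost in passing from `|f|` to `|g|`, another in passing from `g` back to `f` in the
  -- pairing.
  refine le_of_forall_pos_le_add_mul (K := 2) fun ε hε => ?_
  obtain ⟨g, hgs, hgd, hgc, hgi⟩ := hf.exists_hasCompactSupport_integral_sub_le hε
  have h1 : ∫ x, |f x| ≤ ε + ∫ x, |g x| := by
    have : ∫ x, |f x| ≤ ∫ x, (‖f x - g x‖ + |g x|) :=
      integral_mono hf.abs ((hf.sub hgi).norm.add hgi.abs) fun x => by
        have := abs_sub_abs_le_abs_sub (f x) (g x)
        simp only [Real.norm_eq_abs]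
        linarith
    have h2 : ∫ x, (‖f x - g x‖ + |g x|) = (∫ x, ‖f x - g x‖) + ∫ x, |g x| :=
      integral_add (hf.sub hgi).norm hgi.abs
    linarith
  suffices ∫ x, |g x| ≤ C + ε by linarith
  refine le_of_forall_pos_le_add_mul (K := volume.real (tsupport g)) fun δ hδ => ?_
  -- A continuous substitute for the sign of `g`: `g φ ≥ |g| - δ`, so the loss is at most `δ` on the
  -- compact support.
  set φ : RN N → ℝ := fun x => g x / (|g x| + δ) with hφdef
  have hpos : ∀ x, 0 < |g x| + δ := fun x => by positivity
  have hφc : Continuous φ := hgc.div (by fun_prop) fun x => (hpos x).ne'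
  have hφs : HasCompactSupport φ := by
    refine hgs.mono fun x hx => ?_
    rw [Function.mem_support] at hx ⊢
    intro h
    exact hx (by simp [hφdef, h])
  have hφ1 : ∀ x, |φ x| ≤ 1 := fun x => by
    rw [hφdef, abs_div, abs_of_pos (hpos x), div_le_one (hpos x)]
    linarith
  have hfφ : Integrable (fun x => f x * φ x) :=
    hf.mul_bdd (c := 1) hφc.aestronglyMeasurable (ae_of_all _ hφ1)
  have hind : Integrable ((tsupport g).indicator fun _ => δ) :=
    (integrable_indicator_iff hgs.isCompact.isClosed.measurableSet).2
      (integrableOn_const hgs.isCompact.measure_lt_top.ne)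
  have hpt : ∀ x, |g x| ≤ f x * φ x + ‖f x - g x‖ + (tsupport g).indicator (fun _ => δ) x := by
    intro x
    have h2 : (g x - f x) * φ x ≤ ‖f x - g x‖ := by
      rw [norm_sub_rev, Real.norm_eq_abs]
      refine (le_abs_self _).trans ?_
      rw [abs_mul]
      exact mul_le_of_le_one_right (abs_nonneg _) (hφ1 x)
    have h3 : |g x| ≤ g x * φ x + (tsupport g).indicator (fun _ => δ) x := by
      by_cases hx : g x = 0
      · rw [hx, abs_zero, zero_mul, zero_add]
        exact Set.indicator_nonneg (fun _ _ => hδ.le) x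
      · rw [Set.indicator_of_mem (subset_tsupport _ hx)]
        have : g x * φ x = |g x| ^ 2 / (|g x| + δ) := by
          rw [hφdef, sq_abs]; ring
        rw [this, ← sub_le_iff_le_add, le_div_iff₀ (hpos x)]
        nlinarith [abs_nonneg (g x)]
    linarith
  have h4 := integral_mono hgi.abs ((hfφ.add (hf.sub hgi).norm).add hind) hpt
  have h5 : ∫ x, (tsupport g).indicator (fun _ => δ) x = δ * volume.real (tsupport g) := by
    rw [integral_indicator_const _ hgs.isCompact.isClosed.measurableSet, smul_eq_mul, mul_comm]
  have h6 : ∫ x, (f x * φ x + ‖f x - g x‖ + (tsupport g).indicator (fun _ => δ) x) =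
      (∫ x, f x * φ x) + (∫ x, ‖f x - g x‖) + δ * volume.real (tsupport g) := by
    have e : ∫ x, (f x * φ x + ‖f x - g x‖) = (∫ x, f x * φ x) + ∫ x, ‖f x - g x‖ :=
      integral_add hfφ (hf.sub hgi).norm
    rw [← h5, ← e]
    exact integral_add (hfφ.add (hf.sub hgi).norm) hind
  have h7 := h φ hφc hφs hφ1
  have h8 : ∫ x, |g x| ≤ _ := h4.trans_eq h6
  linarith

/-- Second-order differences of `BV²` functions are of second order in `L¹`. -/
lemma integral_abs_secondDiff_le (hu : Integrable u) (hg : IsWeakGradient u g)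
    (hD : IsMeasureDeriv g D) (h : RN N) :
    ∫ x, |secondDiff u h x| ≤ 3 * totalMass D * ‖h‖ ^ 2 := by
  -- The 3 is 2 from the oscillation of `φ` plus 1 from the quadratic form, as `|φ| ≤ 1`.
  refine integral_abs_le_of_forall (integrable_secondDiff hu h) fun φ hφ hs h1 => ?_
  have h0 : Tendsto φ (cocompact _) (𝓝 0) := hs.is_zero_at_infty
  have a1 := abs_le.1 (abs_integral_secondDiff_mul_sub_le_of_bound hu hg hD hφ h0 h1 h)
  have a2 := abs_le.1 (abs_quadIntegral_le D h hφ h1)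
  linarith [a1.2, a2.2]

end SecondDiff

/-! ### Fourth moments of radial weights. -/

section Moments

variable {N : ℕ} {r : RN N → ℝ}

open scoped RealInnerProductSpace

/-- The fourth-order moment of the weight `r`, normalized to be homogeneous of degree zero. -/
noncomputable def moment (r : RN N → ℝ) (a b c d : RN N) : ℝ :=
  ∫ h, ⟪a, h⟫ * ⟪b, h⟫ * ⟪c, h⟫ * ⟪d, h⟫ / ‖h‖ ^ 4 * r h

lemma integrable_moment (hr : Integrable r) (a b c d : RN N) :
    Integrable fun h => ⟪a, h⟫ * ⟪b, h⟫ * ⟪c, h⟫ * ⟪d, h⟫ / ‖h‖ ^ 4 * r h := by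
  refine hr.bdd_mul (c := ‖a‖ * ‖b‖ * ‖c‖ * ‖d‖)
    (Measurable.aestronglyMeasurable (by fun_prop)) (ae_of_all _ fun h => ?_)
  rw [norm_div, norm_mul, norm_mul, norm_mul, norm_pow, norm_norm]
  refine div_le_of_le_mul₀ (by positivity) (by positivity) ?_
  calc ‖⟪a, h⟫‖ * ‖⟪b, h⟫‖ * ‖⟪c, h⟫‖ * ‖⟪d, h⟫‖
      ≤ (‖a‖ * ‖h‖) * (‖b‖ * ‖h‖) * (‖c‖ * ‖h‖) * (‖d‖ * ‖h‖) := by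
        gcongr <;> exact norm_inner_le_norm _ _
    _ = ‖a‖ * ‖b‖ * ‖c‖ * ‖d‖ * ‖h‖ ^ 4 := by ring

/-- The reflection in the hyperplane orthogonal to `v - w` carries `v` to `w` and preserves Lebesgue
measure, norms and `r`. -/
lemma moment_self_eq_of_norm_eq (hr : ∀ x y, ‖x‖ = ‖y‖ → r x = r y) {v w : RN N}
    (hvw : ‖v‖ = ‖w‖) : moment r v v v v = moment r w w w w := by
  set f := Submodule.reflection (ℝ ∙ (v - w))ᗮ
  have hf : f v = w := Submodule.reflection_sub hvw
  have := f.measurePreserving.integral_comp f.toHomeomorph.measurableEmbedding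
    (fun h => ⟪w, h⟫ * ⟪w, h⟫ * ⟪w, h⟫ * ⟪w, h⟫ / ‖h‖ ^ 4 * r h)
  rw [moment, moment, ← this]
  congr 1 with h
  rw [← hf, f.inner_map_map, f.norm_map, hr (f h) h (f.norm_map h)]

lemma exists_moment_self_eq (hr : ∀ x y, ‖x‖ = ‖y‖ → r x = r y) (hN : 1 ≤ N) :
    ∃ c, ∀ v, moment r v v v v = c * ‖v‖ ^ 4 := by
  set e : RN N := EuclideanSpace.single ⟨0, hN⟩ 1
  have he : ‖e‖ = 1 := by simp [e]
  refine ⟨moment r e e e e, fun v => ?_⟩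
  rw [moment_self_eq_of_norm_eq hr (v := v) (w := ‖v‖ • e) (by simp [norm_smul, he]), moment,
    moment, mul_comm, ← integral_const_mul]
  congr 1 with h
  simp only [real_inner_smul_left]
  ring

/-- A fourth-order moment of a radial weight, by polarization. -/
lemma moment_eq_of_moment_self (hi : Integrable r) {c : ℝ}
    (hc : ∀ v, moment r v v v v = 3 * c * ‖v‖ ^ 4) (x y z w : RN N) :
    moment r x y z w = c * (⟪x, y⟫ * ⟪z, w⟫ + ⟪x, z⟫ * ⟪y, w⟫ + ⟪x, w⟫ * ⟪y, z⟫) := by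
  let s : Bool → ℝ := fun b => if b then 1 else -1
  let V : Bool × Bool × Bool → RN N := fun p => x + s p.1 • y + s p.2.1 • z + s p.2.2 • w
  -- The signed sum of `(x ± y ± z ± w)⁴` keeps only monomials odd in each of `y`, `z`, `w`, that is
  -- `xyzw`, with coefficient `8 · 4! = 192`.
  have h1 : 192 * moment r x y z w =
      ∑ p, s p.1 * s p.2.1 * s p.2.2 * moment r (V p) (V p) (V p) (V p) := by
    simp only [moment, ← integral_const_mul]
    rw [← integral_finsetSum _ fun p _ => (integrable_moment hi _ _ _ _).const_mul _]
    congr 1 with h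
    simp only [V, s, inner_add_left, real_inner_smul_left, Fintype.sum_prod_type, Fintype.sum_bool]
    simp only [if_true, Bool.false_eq_true, if_false]
    ring
  have h2 : ∀ p, ‖V p‖ ^ 4 = ⟪V p, V p⟫ ^ 2 := fun p => by
    rw [real_inner_self_eq_norm_sq]; ring
  simp only [hc, h2] at h1
  simp only [V, s, inner_add_left, inner_add_right, real_inner_smul_left, real_inner_smul_right,
    Fintype.sum_prod_type, Fintype.sum_bool, if_true, Bool.false_eq_true, if_false,
    real_inner_comm x y, real_inner_comm x z, real_inner_comm x w, real_inner_comm y z,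
    real_inner_comm y w, real_inner_comm z w] at h1
  linarith

lemma inner_single_one (i : Fin N) (h : RN N) : ⟪EuclideanSpace.single i (1 : ℝ), h⟫ = h i := by
  simp [EuclideanSpace.inner_single_left]

lemma norm_sq_eq_sum (h : RN N) : ‖h‖ ^ 2 = ∑ m, h m * h m := by
  rw [EuclideanSpace.norm_sq_eq]
  exact Finset.sum_congr rfl fun m _ => by rw [Real.norm_eq_abs, sq_abs, sq]

lemma integrable_coord_moment (hi : Integrable r) (i j k l : Fin N) :
    Integrable fun h : RN N => h i * h j * h k * h l / ‖h‖ ^ 4 * r h := by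
  simpa only [inner_single_one] using integrable_moment hi (EuclideanSpace.single i 1)
    (EuclideanSpace.single j 1) (EuclideanSpace.single k 1) (EuclideanSpace.single l 1)

/-- The `(i, j, k, l)` moment of a radial probability density. -/
lemma moment_single (hN : 1 ≤ N) (hr : ∀ x y, ‖x‖ = ‖y‖ → r x = r y) (hi : Integrable r)
    (h1 : ∫ x, r x = 1) (i j k l : Fin N) :
    ∫ h, h i * h j * h k * h l / ‖h‖ ^ 4 * r h = ((N : ℝ) * (N + 2))⁻¹ *
      ((1 : Matrix (Fin N) (Fin N) ℝ) i j * (1 : Matrix (Fin N) (Fin N) ℝ) k l +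
        (1 : Matrix (Fin N) (Fin N) ℝ) i k * (1 : Matrix (Fin N) (Fin N) ℝ) j l +
        (1 : Matrix (Fin N) (Fin N) ℝ) i l * (1 : Matrix (Fin N) (Fin N) ℝ) j k) := by
  have hN0 : (0 : ℝ) < N := by exact_mod_cast hN
  obtain ⟨c, hc⟩ := exists_moment_self_eq hr hN
  let e : Fin N → RN N := fun i => EuclideanSpace.single i 1
  have hinner : ∀ i j, ⟪e i, e j⟫ = (1 : Matrix (Fin N) (Fin N) ℝ) i j := fun i j => by
    simp [e, inner_single_one, Matrix.one_apply]
  have hm : ∀ i j k l, moment r (e i) (e j) (e k) (e l) =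
      ∫ h, h i * h j * h k * h l / ‖h‖ ^ 4 * r h := fun i j k l => by
    simp only [moment, e, inner_single_one]
  have hint := integrable_coord_moment hi
  have hpol := moment_eq_of_moment_self hi (c := c / 3)
    (fun v => by rw [hc v]; ring)
  -- Full contraction replaces the kernel by `‖h‖⁴ / ‖h‖⁴`, and on the isotropic tensor gives `N² +
  -- 2N`; comparing the two determines `c`.
  have hsum : ∑ i, ∑ k, moment r (e i) (e i) (e k) (e k) = 1 := by
    simp only [hm]
    have hs : ∀ i : Fin N, ∑ k, ∫ h : RN N, h i * h i * h k * h k / ‖h‖ ^ 4 * r h =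
        ∫ h : RN N, ∑ k, h i * h i * h k * h k / ‖h‖ ^ 4 * r h := fun i =>
      (integral_finsetSum _ fun k _ => hint i i k k).symm
    simp only [hs]
    rw [← integral_finsetSum _ fun i _ => integrable_finsetSum _ fun k _ => hint i i k k, ← h1]
    -- For `N ≥ 1` the origin is a null set; there the quotient is `0` rather than `1`.
    have : Nonempty (Fin N) := ⟨⟨0, hN⟩⟩
    refine integral_congr_ae ?_
    have h0 : ∀ᵐ h : RN N, h ≠ 0 := by
      simp [ae_iff]
    filter_upwards [h0] with h hh
    have hne : ‖h‖ ≠ 0 := norm_ne_zero_iff.2 hh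
    have e4 : ‖h‖ ^ 4 = ∑ i, ∑ k, h i * h i * h k * h k := by
      rw [show ‖h‖ ^ 4 = ‖h‖ ^ 2 * ‖h‖ ^ 2 by ring, norm_sq_eq_sum, Finset.sum_mul_sum]
      simp only [mul_assoc]
    simp_rw [← Finset.sum_mul, ← Finset.sum_div]
    rw [← e4, div_self (pow_ne_zero _ hne), one_mul]
  have hc' : c / 3 * (N * (N + 2)) = 1 := by
    rw [← hsum]
    simp only [hpol, hinner, ← Finset.mul_sum]
    congr 1
    simp [Matrix.one_apply, Finset.sum_add_distrib]
    ring
  rw [← hm, hpol]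
  simp only [hinner]
  congr 1
  field_simp
  linarith

/-- The weight against which second-order differences are integrated in the `(i, j)` entry of the
non-local Hessian. -/
noncomputable def kernelWeight (r : RN N → ℝ) (i j : Fin N) (h : RN N) : ℝ :=
  kernelMatrix h i j / ‖h‖ ^ 4 * r h

/-- Writing `‖h‖²` as `∑ h_m²` reduces the trace correction to fourth moments as well. -/
lemma kernelWeight_mul_mul (i j k l : Fin N) (h : RN N) :
    kernelWeight r i j h * (h k * h l) = h i * h j * h k * h l / ‖h‖ ^ 4 * r h -
      (1 : Matrix (Fin N) (Fin N) ℝ) i j / (N + 2) *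
        ∑ m, h m * h m * h k * h l / ‖h‖ ^ 4 * r h := by
  have : ∑ m, h m * h m * h k * h l / ‖h‖ ^ 4 * r h = ‖h‖ ^ 2 * h k * h l / ‖h‖ ^ 4 * r h := by
    rw [norm_sq_eq_sum]
    simp only [Finset.sum_mul, Finset.sum_div]
  rw [this, kernelWeight, kernelMatrix]
  simp only [Matrix.sub_apply, Matrix.of_apply, Matrix.smul_apply, smul_eq_mul]
  ring

lemma integrable_kernelWeight_mul_mul (hi : Integrable r) (i j k l : Fin N) :
    Integrable fun h : RN N => kernelWeight r i j h * (h k * h l) := by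
  simp only [kernelWeight_mul_mul]
  exact (integrable_coord_moment hi i j k l).sub
    ((integrable_finsetSum _ fun m _ => integrable_coord_moment hi m m k l).const_mul _)

/-- Contracting the isotropic tensor over one pair gives `(N + 2) δ_kl`, so the correction `1 / (N +
2)` cancels exactly the term `δ_ij δ_kl`. -/
lemma integral_kernelWeight_mul_mul (hN : 1 ≤ N) (hr : ∀ x y, ‖x‖ = ‖y‖ → r x = r y)
    (hi : Integrable r) (h1 : ∫ x, r x = 1) (i j k l : Fin N) :
    ∫ h, kernelWeight r i j h * (h k * h l) = ((N : ℝ) * (N + 2))⁻¹ *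
      ((1 : Matrix (Fin N) (Fin N) ℝ) i k * (1 : Matrix (Fin N) (Fin N) ℝ) j l +
        (1 : Matrix (Fin N) (Fin N) ℝ) i l * (1 : Matrix (Fin N) (Fin N) ℝ) j k) := by
  have hN0 : (0 : ℝ) < N := by exact_mod_cast hN
  have hm : ∑ m : Fin N, (1 : Matrix (Fin N) (Fin N) ℝ) m k * (1 : Matrix (Fin N) (Fin N) ℝ) m l =
      (1 : Matrix (Fin N) (Fin N) ℝ) k l := by
    simp [Matrix.one_apply, eq_comm]
  have hm' : ∑ m : Fin N, (1 : Matrix (Fin N) (Fin N) ℝ) m l * (1 : Matrix (Fin N) (Fin N) ℝ) m k =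
      (1 : Matrix (Fin N) (Fin N) ℝ) k l := by
    simp_rw [← hm, mul_comm]
  simp only [kernelWeight_mul_mul]
  rw [integral_sub (integrable_coord_moment hi i j k l)
    ((integrable_finsetSum _ fun m _ => integrable_coord_moment hi m m k l).const_mul _),
    integral_const_mul, integral_finsetSum _ fun m _ => integrable_coord_moment hi m m k l]
  simp only [moment_single hN hr hi h1, ← Finset.mul_sum, Finset.sum_add_distrib, hm, hm']
  simp only [Matrix.one_apply_eq, one_mul, Finset.sum_const, Finset.card_univ, Fintype.card_fin,
    nsmul_eq_mul]
  field_simp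
  ring

/-- The two surviving terms give `m i j + m j i = 2 m i j`, whence the constant `N(N+2)/2`. -/
lemma integral_kernelWeight_mul_quadratic (hN : 1 ≤ N) (hr : ∀ x y, ‖x‖ = ‖y‖ → r x = r y)
    (hi : Integrable r) (h1 : ∫ x, r x = 1) {m : Fin N → Fin N → ℝ} (hm : ∀ k l, m k l = m l k)
    (i j : Fin N) :
    (N : ℝ) * (N + 2) / 2 * ∫ h, kernelWeight r i j h * ∑ k, ∑ l, h k * h l * m l k = m i j := by
  have hN0 : (0 : ℝ) < N := by exact_mod_cast hN
  have e : ∀ h : RN N, kernelWeight r i j h * ∑ k, ∑ l, h k * h l * m l k =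
      ∑ k, ∑ l, m l k * (kernelWeight r i j h * (h k * h l)) := fun h => by
    simp only [Finset.mul_sum]
    exact Finset.sum_congr rfl fun k _ => Finset.sum_congr rfl fun l _ => by ring
  have hint := fun k l => (integrable_kernelWeight_mul_mul hi i j k l).const_mul (m l k)
  simp only [e]
  rw [integral_finsetSum _ fun k _ => integrable_finsetSum _ fun l _ => hint k l]
  simp_rw [integral_finsetSum _ fun l _ => hint _ l, integral_const_mul,
    integral_kernelWeight_mul_mul hN hr hi h1]
  have : ∑ k, ∑ l, m l k * (((N : ℝ) * (N + 2))⁻¹ *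
      ((1 : Matrix (Fin N) (Fin N) ℝ) i k * (1 : Matrix (Fin N) (Fin N) ℝ) j l +
        (1 : Matrix (Fin N) (Fin N) ℝ) i l * (1 : Matrix (Fin N) (Fin N) ℝ) j k)) =
      ((N : ℝ) * (N + 2))⁻¹ * (m j i + m i j) := by
    simp only [Matrix.one_apply, mul_add, mul_ite, mul_one, mul_zero,
      Finset.sum_add_distrib, Finset.sum_ite_eq, Finset.mem_univ, if_true, Finset.sum_ite_irrel,
      Finset.sum_const_zero]
    ring
  rw [this, hm j i]
  field_simp
  ring

lemma abs_kernelMatrix_le (i j : Fin N) (h : RN N) : |kernelMatrix h i j| ≤ 2 * ‖h‖ ^ 2 := by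
  have hi := abs_coord_le h i
  have hj := abs_coord_le h j
  have h1 : |h i * h j| ≤ ‖h‖ ^ 2 := by
    rw [abs_mul, sq]
    gcongr
  have h2 : |‖h‖ ^ 2 / ((N : ℝ) + 2) * (1 : Matrix (Fin N) (Fin N) ℝ) i j| ≤ ‖h‖ ^ 2 := by
    rw [abs_mul, abs_of_nonneg (by positivity : 0 ≤ ‖h‖ ^ 2 / ((N : ℝ) + 2))]
    have : |(1 : Matrix (Fin N) (Fin N) ℝ) i j| ≤ 1 := by
      rw [Matrix.one_apply]; split_ifs <;> simp
    have h3 : ‖h‖ ^ 2 / ((N : ℝ) + 2) ≤ ‖h‖ ^ 2 :=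
      div_le_self (by positivity) (by linarith [(Nat.cast_nonneg N : (0 : ℝ) ≤ N)])
    calc _ ≤ ‖h‖ ^ 2 * 1 := by gcongr
      _ = _ := mul_one _
  simp only [kernelMatrix, Matrix.sub_apply, Matrix.of_apply, Matrix.smul_apply, smul_eq_mul]
  linarith [abs_sub (h i * h j) (‖h‖ ^ 2 / ((N : ℝ) + 2) * (1 : Matrix (Fin N) (Fin N) ℝ) i j)]

lemma abs_kernelWeight_mul_norm_sq_le (hr : ∀ x, 0 ≤ r x) (i j : Fin N) (h : RN N) :
    |kernelWeight r i j h| * ‖h‖ ^ 2 ≤ 2 * r h := by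
  rw [kernelWeight, abs_mul, abs_div, abs_of_nonneg (hr h),
    abs_of_nonneg (by positivity : 0 ≤ ‖h‖ ^ 4),
    mul_right_comm]
  gcongr
  · exact hr h
  rw [div_mul_eq_mul_div]
  refine div_le_of_le_mul₀ (by positivity) (by positivity) ?_
  calc |kernelMatrix h i j| * ‖h‖ ^ 2 ≤ 2 * ‖h‖ ^ 2 * ‖h‖ ^ 2 := by
        gcongr; exact abs_kernelMatrix_le i j h
    _ = 2 * ‖h‖ ^ 4 := by ring

lemma aestronglyMeasurable_kernelWeight (hi : Integrable r) (i j : Fin N) :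
    AEStronglyMeasurable (kernelWeight r i j) := by
  refine AEStronglyMeasurable.mul (Measurable.aestronglyMeasurable ?_) hi.aestronglyMeasurable
  simp only [kernelMatrix, Matrix.sub_apply, Matrix.of_apply, Matrix.smul_apply, smul_eq_mul]
  fun_prop

end Moments

/-! ### Integrability, Fubini and convergence. -/

section Convergence

variable {N : ℕ} {r u : RN N → ℝ} {g : Fin N → RN N → ℝ}
  {D : Fin N → Fin N → SignedMeasure (RN N)}

lemma hessianIntegrand_eq (i j : Fin N) (x h : RN N) :
    hessianIntegrand r u i j x h = kernelWeight r i j h * secondDiff u h x := by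
  rw [hessianIntegrand, kernelWeight, secondDiff]
  ring

/-- Integrating in `x` first, the `O(‖h‖²)` bound in `L¹` cancels the singularity of the weight and
leaves a multiple of `r`. -/
lemma integrable_prod_hessianIntegrand (hr0 : ∀ x, 0 ≤ r x) (hr : Integrable r)
    (hu : Integrable u) (hg : IsWeakGradient u g) (hD : IsMeasureDeriv g D) (i j : Fin N) :
    Integrable (fun p : RN N × RN N => hessianIntegrand r u i j p.1 p.2)
      (volume.prod volume) := by
  have hm : AEStronglyMeasurable (fun p : RN N × RN N => hessianIntegrand r u i j p.1 p.2)
      (volume.prod volume) := by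
    simp only [hessianIntegrand_eq, secondDiff]
    refine (aestronglyMeasurable_kernelWeight hr i j).comp_snd.mul (((?_ :
      AEStronglyMeasurable (fun p : RN N × RN N => u (p.1 + p.2)) _).sub
        (hu.aestronglyMeasurable.comp_fst.const_mul 2)).add ?_)
    · exact hu.aestronglyMeasurable.comp_quasiMeasurePreserving
        (quasiMeasurePreserving_add volume volume)
    · exact hu.aestronglyMeasurable.comp_quasiMeasurePreserving
        (quasiMeasurePreserving_sub_of_right_invariant volume volume)
  rw [integrable_prod_iff' hm]
  have hnorm : ∀ h, ∫ x, ‖hessianIntegrand r u i j x h‖ =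
      |kernelWeight r i j h| * ∫ x, |secondDiff u h x| := fun h => by
    rw [← integral_const_mul]
    simp only [hessianIntegrand_eq, norm_mul, Real.norm_eq_abs]
  refine ⟨ae_of_all _ fun h => ?_, ?_⟩
  · simp only [hessianIntegrand_eq]
    exact (integrable_secondDiff hu h).const_mul _
  · refine (hr.const_mul (6 * totalMass D)).mono' hm.norm.prod_swap.integral_prod_right'
      (ae_of_all _ fun h => ?_)
    simp only [hnorm]
    rw [Real.norm_of_nonneg (by positivity)]
    calc |kernelWeight r i j h| * ∫ x, |secondDiff u h x|
        ≤ |kernelWeight r i j h| * (3 * totalMass D * ‖h‖ ^ 2) := by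
          gcongr
          exact integral_abs_secondDiff_le hu hg hD h
      _ = 3 * totalMass D * (|kernelWeight r i j h| * ‖h‖ ^ 2) := by ring
      _ ≤ 3 * totalMass D * (2 * r h) := by
          have := totalMass_nonneg D
          exact mul_le_mul_of_nonneg_left (abs_kernelWeight_mul_norm_sq_le hr0 i j h) (by positivity)
      _ = 6 * totalMass D * r h := by ring

lemma integrable_nonlocalHessian (hr0 : ∀ x, 0 ≤ r x) (hr : Integrable r)
    (hu : Integrable u) (hg : IsWeakGradient u g) (hD : IsMeasureDeriv g D) (i j : Fin N) :
    Integrable fun x => nonlocalHessian r u x i j := by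
  simp only [nonlocalHessian, Matrix.of_apply]
  exact (integrable_prod_hessianIntegrand hr0 hr hu hg hD i j).integral_prod_left.const_mul _

/-- Fubini's theorem for the non-local Hessian tested against a bounded continuous function. -/
lemma integral_nonlocalHessian_mul (hr0 : ∀ x, 0 ≤ r x) (hr : Integrable r)
    (hu : Integrable u) (hg : IsWeakGradient u g) (hD : IsMeasureDeriv g D) (i j : Fin N)
    {φ : RN N → ℝ} (hφ : Continuous φ) {C : ℝ} (hC : ∀ x, |φ x| ≤ C) :
    (Integrable fun h => kernelWeight r i j h * ∫ x, secondDiff u h x * φ x) ∧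
    ∫ x, nonlocalHessian r u x i j * φ x =
      (N : ℝ) * (N + 2) / 2 * ∫ h, kernelWeight r i j h * ∫ x, secondDiff u h x * φ x := by
  have hprod : Integrable (fun p : RN N × RN N => hessianIntegrand r u i j p.1 p.2 * φ p.1)
      (volume.prod volume) :=
    (integrable_prod_hessianIntegrand hr0 hr hu hg hD i j).mul_bdd (c := C)
      (hφ.comp continuous_fst).aestronglyMeasurable (ae_of_all _ fun p => hC _)
  have e : ∀ h, ∫ x, hessianIntegrand r u i j x h * φ x =
      kernelWeight r i j h * ∫ x, secondDiff u h x * φ x := fun h => by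
    rw [← integral_const_mul]
    simp only [hessianIntegrand_eq, mul_assoc]
  constructor
  · simpa only [e] using hprod.integral_prod_right
  · simp only [nonlocalHessian, Matrix.of_apply]
    simp_rw [mul_assoc ((N : ℝ) * (N + 2) / 2), integral_const_mul, ← integral_mul_const]
    rw [integral_integral_swap hprod]
    simp only [e]

/-- Quantitative convergence of the non-local Hessian, in terms of the oscillation of `φ` at
scale `δ` and of the mass of the weight away from the origin. -/
lemma abs_integral_nonlocalHessian_mul_sub_le (hN : 1 ≤ N) (hr0 : ∀ x, 0 ≤ r x)
    (hrad : ∀ x y, ‖x‖ = ‖y‖ → r x = r y) (hr : Integrable r) (h1 : ∫ x, r x = 1)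
    (hu : Integrable u) (hg : IsWeakGradient u g) (hD : IsMeasureDeriv g D) (i j : Fin N)
    {φ : RN N → ℝ} (hφ : Continuous φ) (h0 : Tendsto φ (cocompact _) (𝓝 0)) {S : ℝ}
    (hS : ∀ x, |φ x| ≤ S) {ε δ : ℝ} (hε : 0 ≤ ε)
    (hδ : ∀ x y, ‖y‖ ≤ δ → |φ (x + y) - φ x| ≤ ε) :
    |(∫ x, nonlocalHessian r u x i j * φ x) - signedIntegral (D i j) φ| ≤
      (N : ℝ) * (N + 2) * totalMass D * (ε + 2 * S * ∫ x in {x | δ < ‖x‖}, r x) := by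
  obtain ⟨hi1, he⟩ := integral_nonlocalHessian_mul hr0 hr hu hg hD i j hφ hS
  have hS0 : 0 ≤ S := (abs_nonneg _).trans (hS 0)
  have hV := totalMass_nonneg D
  have hi2 : Integrable fun h => kernelWeight r i j h * quadIntegral D h φ := by
    simp only [quadIntegral, Finset.mul_sum]
    refine integrable_finsetSum _ fun k _ => integrable_finsetSum _ fun l _ => ?_
    simp only [← mul_assoc]
    simpa only [← mul_assoc] using
      (integrable_kernelWeight_mul_mul hr i j k l).mul_const (signedIntegral (D l k) φ)
  -- The limit is itself an average against the same weight, so the error can be estimated for each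
  -- `h` separately.
  have hq : (N : ℝ) * (N + 2) / 2 * ∫ h, kernelWeight r i j h * quadIntegral D h φ =
      signedIntegral (D i j) φ := integral_kernelWeight_mul_quadratic hN hrad hr h1
    (m := fun k l => signedIntegral (D k l) φ) (signedIntegral_comm hg hD hφ h0) i j
  have hms : MeasurableSet {x : RN N | δ < ‖x‖} := measurableSet_lt measurable_const measurable_norm
  have hbd : Integrable fun h => 2 * totalMass D * (ε * r h +
      2 * S * {x : RN N | δ < ‖x‖}.indicator r h) :=
    ((hr.const_mul ε).add ((hr.indicator hms).const_mul _)).const_mul _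
  rw [he, ← hq, ← mul_sub, abs_mul, abs_of_nonneg (by positivity)]
  rw [← integral_sub hi1 hi2]
  have hmain : |∫ h, (kernelWeight r i j h * (∫ x, secondDiff u h x * φ x) -
      kernelWeight r i j h * quadIntegral D h φ)| ≤
      ∫ h, 2 * totalMass D * (ε * r h + 2 * S * {x : RN N | δ < ‖x‖}.indicator r h) := by
    rw [← Real.norm_eq_abs]
    refine norm_integral_le_of_norm_le hbd (ae_of_all _ fun h => ?_)
    rw [← mul_sub, Real.norm_eq_abs, abs_mul]
    have key : ∀ W : ℝ, 0 ≤ W →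
        |(∫ x, secondDiff u h x * φ x) - quadIntegral D h φ| ≤ ‖h‖ ^ 2 * W * totalMass D →
        |kernelWeight r i j h| * |(∫ x, secondDiff u h x * φ x) - quadIntegral D h φ| ≤
          2 * totalMass D * (W * r h) := fun W hW hle =>
      calc _ ≤ |kernelWeight r i j h| * (‖h‖ ^ 2 * W * totalMass D) := by gcongr
        _ = (|kernelWeight r i j h| * ‖h‖ ^ 2) * (W * totalMass D) := by ring
        _ ≤ (2 * r h) * (W * totalMass D) :=
            mul_le_mul_of_nonneg_right (abs_kernelWeight_mul_norm_sq_le hr0 i j h) (by positivity)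
        _ = _ := by ring
    -- Far from the origin only the bound on `φ` is available, paid for by the tail mass; near it,
    -- the oscillation is at most `ε`.
    by_cases hh : δ < ‖h‖
    · refine (key (2 * S) (by positivity)
        (abs_integral_secondDiff_mul_sub_le_of_bound hu hg hD hφ h0 hS h)).trans ?_
      rw [Set.indicator_of_mem (by exact hh)]
      have := mul_nonneg hε (hr0 h)
      gcongr
      linarith
    · refine (key ε hε (abs_integral_secondDiff_mul_sub_le hu hg hD hφ h0 fun x y hy =>
        hδ x y (hy.trans (not_lt.1 hh)))).trans (le_of_eq ?_)
      rw [Set.indicator_of_notMem (by exact hh)]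
      ring
  rw [integral_const_mul, integral_add (hr.const_mul ε) ((hr.indicator hms).const_mul _),
    integral_const_mul, integral_const_mul, h1, integral_indicator hms] at hmain
  refine (mul_le_mul_of_nonneg_left hmain (by positivity)).trans (le_of_eq ?_)
  ring

lemma tendsto_integral_nonlocalHessian_mul (hN : 1 ≤ N) {ρ : ℕ → RN N → ℝ}
    (hρ : IsRadialMollifierSeq ρ)
    (hu : Integrable u) (hg : IsWeakGradient u g) (hD : IsMeasureDeriv g D) (i j : Fin N)
    {φ : RN N → ℝ} (hφ : Continuous φ) (h0 : Tendsto φ (cocompact _) (𝓝 0)) :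
    Tendsto (fun n => ∫ x, nonlocalHessian (ρ n) u x i j * φ x) atTop
      (𝓝 (signedIntegral (D i j) φ)) := by
  obtain ⟨S, hS⟩ := exists_bound_of_tendsto_cocompact hφ h0
  have huc : UniformContinuous φ := hφ.uniformContinuous_of_tendsto_cocompact h0
  set K : ℝ := (N : ℝ) * (N + 2) * totalMass D with hK
  have hK0 : 0 ≤ K := mul_nonneg (by positivity) (totalMass_nonneg D)
  rw [Metric.tendsto_nhds]
  intro η hη
  -- `K + 1` keeps the quotient meaningful when `K = 0`; below, `δ / 2` turns the strict inequality
  -- of uniform continuity into a non-strict one.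
  obtain ⟨δ, hδ, hδε⟩ := Metric.uniformContinuous_iff.1 huc (η / (K + 1)) (by positivity)
  have hlim : Tendsto (fun n => K * (η / (K + 1) + 2 * S * ∫ x in {x | δ / 2 < ‖x‖}, ρ n x)) atTop
      (𝓝 (K * (η / (K + 1) + 2 * S * 0))) :=
    (((hρ.tendsto_tail (δ / 2) (by positivity)).const_mul _).const_add _).const_mul _
  have hlt : K * (η / (K + 1) + 2 * S * 0) < η := by
    rw [mul_zero, add_zero, mul_div_assoc', div_lt_iff₀ (by positivity)]
    linarith
  filter_upwards [hlim.eventually_lt_const hlt] with n hn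
  rw [Real.dist_eq]
  refine lt_of_le_of_lt (abs_integral_nonlocalHessian_mul_sub_le hN (hρ.nonneg n) (hρ.radial n)
    (hρ.integrable n) (hρ.integral_eq_one n) hu hg hD i j hφ h0 hS (by positivity)
    fun x y hy => ?_) hn
  have := hδε (a := x + y) (b := x) (by rw [dist_eq_norm, add_sub_cancel_left]; linarith)
  exact (by simpa [Real.dist_eq] using this : |φ (x + y) - φ x| < _).le

end Convergence

end NonlocalHessian

/-! ### The theorem, assembled from its scalar entries. -/

open NonlocalHessian in
theorem theorem1p6 {N : ℕ} (hN : 1 ≤ N) (ρ : ℕ → NonlocalHessian.RN N → ℝ)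
    (hρ : NonlocalHessian.IsRadialMollifierSeq ρ)
    (u : NonlocalHessian.RN N → ℝ) (hu : NonlocalHessian.MemBV2 u)
    (D : Fin N → Fin N → SignedMeasure (NonlocalHessian.RN N))
    (hD : NonlocalHessian.IsHessianMeasure u D) :
    (∀ n, ∀ᵐ x, ∀ i j, Integrable (NonlocalHessian.hessianIntegrand (ρ n) u i j x)) ∧
    (∀ n i j, Integrable (fun x => NonlocalHessian.nonlocalHessian (ρ n) u x i j)) ∧
    NonlocalHessian.TendstoWeakStar
      (fun n => NonlocalHessian.nonlocalHessianMeasure (ρ n) u) D ∧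
    ∀ φ : C₀(NonlocalHessian.RN N, Matrix (Fin N) (Fin N) ℝ),
      Tendsto
        (fun n => ∫ x, ∑ i, ∑ j, NonlocalHessian.nonlocalHessian (ρ n) u x i j * φ x i j)
        atTop (𝓝 (NonlocalHessian.pairing φ D)) := by
  obtain ⟨g, hg, hD⟩ := hD
  have hu1 : Integrable u := hu.1.1
  have hint : ∀ n i j, Integrable (fun x => nonlocalHessian (ρ n) u x i j) := fun n =>
    integrable_nonlocalHessian (hρ.nonneg n) (hρ.integrable n) hu1 hg hD
  have hcont : ∀ (φ : C₀(RN N, Matrix (Fin N) (Fin N) ℝ)) i j, Continuous fun x => φ x i j :=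
    fun φ i j => φ.continuous.matrix_elem i j
  have hzero : ∀ (φ : C₀(RN N, Matrix (Fin N) (Fin N) ℝ)) i j,
      Tendsto (fun x => φ x i j) (cocompact _) (𝓝 0) := fun φ i j =>
    ((continuous_id.matrix_elem i j).tendsto (0 : Matrix (Fin N) (Fin N) ℝ)).comp φ.zero_at_infty'
  have hlim : ∀ φ : C₀(RN N, Matrix (Fin N) (Fin N) ℝ),
      Tendsto (fun n => ∑ i, ∑ j, ∫ x, nonlocalHessian (ρ n) u x i j * φ x i j) atTop
        (𝓝 (pairing φ D)) := fun φ =>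
    tendsto_finsetSum _ fun i _ => tendsto_finsetSum _ fun j _ =>
      tendsto_integral_nonlocalHessian_mul hN hρ hu1 hg hD i j (hcont φ i j) (hzero φ i j)
  refine ⟨fun n => ?_, hint, fun φ => ?_, fun φ => ?_⟩
  · rw [ae_all_iff]
    intro i
    rw [ae_all_iff]
    intro j
    exact (integrable_prod_hessianIntegrand (hρ.nonneg n) (hρ.integrable n) hu1 hg hD
      i j).prod_right_ae
  · refine (hlim φ).congr fun n => ?_
    simp only [pairing]
    refine Finset.sum_congr rfl fun i _ => Finset.sum_congr rfl fun j _ => ?_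
    obtain ⟨C, hC⟩ := exists_bound_of_tendsto_cocompact (hcont φ i j) (hzero φ i j)
    exact (signedIntegral_withDensityᵥ (hint n i j) (hcont φ i j) hC).symm
  · refine (hlim φ).congr fun n => ?_
    have hi : ∀ i j, Integrable fun x => nonlocalHessian (ρ n) u x i j * φ x i j := fun i j => by
      obtain ⟨C, hC⟩ := exists_bound_of_tendsto_cocompact (hcont φ i j) (hzero φ i j)
      exact (hint n i j).mul_bdd (c := C) (hcont φ i j).aestronglyMeasurable (ae_of_all _ hC)
    rw [integral_finsetSum _ fun i _ => integrable_finsetSum _ fun j _ => hi i j]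
    exact Finset.sum_congr rfl fun i _ => (integral_finsetSum _ fun j _ => hi i j).symm
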